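/- Setting. Let $d\ge1$, $c\ge2$, $\widetilde d=d(c-1)$, and consider multinomial logistic regression with $c$ classes: for $\theta=(\theta_1,\dots,\theta_{c-1})\in\mathbb R^{\widetilde d}$ and $x\in\mathbb R^d$, $p(y\mid x,\theta)\propto\exp(\langle\theta_y,x\rangle)$ for $y<c$ and $p(c\mid x,\theta)\propto 1$. Let $H(x,\theta)=\mathbb E_{y\sim p(\cdot\mid x,\theta)}[\nabla_\theta\ell\,\nabla_\theta\ell^{\top}]$ with $\ell=-\log p(y\mid x,\theta)$ be the Fisher information matrix at $x$ (it equals $\nabla^2_\theta\ell$). Fix $\theta_0\in\mathbb R^{\widetilde d}$, labelled points $X_0$ (a finite family), a pool $x_1,\dots,x_m\in\mathbb R^d$, and a probability measure $p$ on $\mathbb R^d$ for which $H_p(\theta_0)=\mathbb E_{x\sim p}[H(x,\theta_0)]$ is finite. For a batch size $b$ put $H(x)=H(x,\theta_0)+\frac1b\sum_{x'\in X_0}H(x',\theta_0)$ and, for positive definite $\Sigma$, $f(\Sigma)=\langle\Sigma^{-1},H_p(\theta_0)\rangle$. Let $f^*$ be the minimum of $f(\sum_{i\in X}H(x_i))$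 over $X\subset\{1,\dots,m\}$ with $|X|=b$ (and positive definite sum). Let $z_\diamond$ minimize the relaxed objective $f(\sum_i z_iH(x_i))$ over $z\in\mathbb R_{\ge0}^m$ with $\sum_iz_i=b$ (and positive definite sum), and let $\Sigma_\diamond=\sum_i z_{\diamond,i}H(x_i)$, $\widetilde H(x_i)=\Sigma_\diamond^{-1/2}H(x_i)\Sigma_\diamond^{-1/2}$. Rounding algorithm with learning rate $\eta>0$. For $t=1,\dots,b$ let $$A_t=\arg\min_{A\succeq0,\ \mathrm{Tr}A=1}\Big\{\eta\sum_{l<t}\langle A,F_l\rangle-2\,\mathrm{Tr}(A^{1/2})\Big\},\qquad i_t\in\arg\max_{1\le i\le m}\mathrm{Tr}\big[A_t^{1/2}-(A_t^{-1/2}+\eta\widetilde H(x_i))^{-1}\big],\qquad F_t=\widetilde H(x_{i_t}).$$ Theorem. Let $\epsilon\in(0,1)$, let $b$ be an integer with $b\ge 32\widetilde d/\epsilon^2+16\sqrt{\widetilde d}/\epsilon^2$, and let $\eta=8\sqrt{\widetilde d}/\epsilon$. Then every run of the rounding algorithm satisfies $$\lambda_{\min}\Big(\sum_{t=1}^bF_t\Big)\ge\frac1{1+\epsilon}.$$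 Hence $\sum_{t=1}^bH(x_{i_t})$ is positive definite and, whenever the selection problem is feasible (so that $f^*$ is defined), $$f\Big(\sum_{t=1}^bH(x_{i_t})\Big)\le(1+\epsilon)\,f^*.$$ -/

import Mathlib

open scoped MatrixOrder

noncomputable section

namespace ActiveSelection

/-! ### Multinomial logistic regression with `k + 1` classes and features in `ℝᵈ` -/

/-- Index set of the parameter `θ`: one weight vector in `ℝᵈ` for each of the first `k` classes,
so that the parameter has dimension `d * k`. -/
abbrev ParamIdx (k d : ℕ) : Type := Fin k × Fin d

/-- Logits: `⟨θ_y, x⟩` for the first `k` classes and `0` for the last (reference) class. -/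
def logit {k d : ℕ} (x : Fin d → ℝ) (y : Fin (k + 1)) (θ : ParamIdx k d → ℝ) : ℝ :=
  Fin.lastCases (motive := fun _ => ℝ) 0 (fun a : Fin k => ∑ j, θ (a, j) * x j) y

/-- The class probability `p(y | x, θ)`. -/
def classProb {k d : ℕ} (x : Fin d → ℝ) (y : Fin (k + 1)) (θ : ParamIdx k d → ℝ) : ℝ :=
  Real.exp (logit x y θ) / ∑ y', Real.exp (logit x y' θ)

/-- The negative log-likelihood loss `ℓ_{(x,y)}(θ) = - log p(y | x, θ)`. -/
def loss {k d : ℕ} (x : Fin d → ℝ) (y : Fin (k + 1)) (θ : ParamIdx k d → ℝ) : ℝ :=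
  -Real.log (classProb x y θ)

/-- The gradient in `θ` of the loss, as the vector of its partial derivatives. -/
def lossGrad {k d : ℕ} (x : Fin d → ℝ) (y : Fin (k + 1)) (θ : ParamIdx k d → ℝ) :
    ParamIdx k d → ℝ :=
  fun a => fderiv ℝ (loss x y) θ (Pi.single a 1)

/-- The Hessian in `θ` of the loss, as the matrix of its second partial derivatives. -/
def lossHessian {k d : ℕ} (x : Fin d → ℝ) (y : Fin (k + 1)) (θ : ParamIdx k d → ℝ) :
    Matrix (ParamIdx k d) (ParamIdx k d) ℝ :=
  Matrix.of fun a a' => fderiv ℝ (fun θ' => lossGrad x y θ' a) θ (Pi.single a' 1)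

/-- The Fisher information matrix `H(x, θ) = 𝔼_{y ∼ p(· | x, θ)} [∇ℓ ∇ℓᵀ]` at the point `x`.  -/
def fisherInfo {k d : ℕ} (θ : ParamIdx k d → ℝ) (x : Fin d → ℝ) :
    Matrix (ParamIdx k d) (ParamIdx k d) ℝ :=
  ∑ y, classProb x y θ • Matrix.vecMulVec (lossGrad x y θ) (lossGrad x y θ)

/-- The Fisher information matrix `H_p(θ) = 𝔼_{x ∼ p} [H(x, θ)]` (entrywise expectation). -/
def fisherInfoMean {k d : ℕ} (p : MeasureTheory.Measure (Fin d → ℝ)) (θ : ParamIdx k d → ℝ) :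
    Matrix (ParamIdx k d) (ParamIdx k d) ℝ :=
  Matrix.of fun a a' => ∫ x, fisherInfo θ x a a' ∂p

/-! #### Sanity checks: the Fisher information in closed form, and as a Hessian -/

/-- The logit of class `y` as a linear functional of `θ`. -/
def logitCLM {k d : ℕ} (x : Fin d → ℝ) (y : Fin (k + 1)) : (ParamIdx k d → ℝ) →L[ℝ] ℝ :=
  Fin.lastCases (motive := fun _ => (ParamIdx k d → ℝ) →L[ℝ] ℝ) 0
    (fun a : Fin k => ∑ j, x j • ContinuousLinearMap.proj (R := ℝ) (φ := fun _ => ℝ) (a, j)) y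

theorem logitCLM_apply {k d : ℕ} (x : Fin d → ℝ) (y : Fin (k + 1)) (θ : ParamIdx k d → ℝ) :
    logitCLM x y θ = logit x y θ := by
  refine Fin.lastCases ?_ (fun b => ?_) y
  · simp [logit, logitCLM]
  · simp [logit, logitCLM, mul_comm]

theorem hasFDerivAt_logit {k d : ℕ} (x : Fin d → ℝ) (y : Fin (k + 1)) (θ : ParamIdx k d → ℝ) :
    HasFDerivAt (logit x y) (logitCLM x y) θ := by
  have h : logit x y = logitCLM x y := funext fun θ => (logitCLM_apply x y θ).symm
  rw [h]
  exact (logitCLM x y).hasFDerivAt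

theorem sum_exp_logit_pos {k d : ℕ} (x : Fin d → ℝ) (θ : ParamIdx k d → ℝ) :
    0 < ∑ y, Real.exp (logit x y θ) :=
  Finset.sum_pos (fun _ _ => Real.exp_pos _) Finset.univ_nonempty

theorem sum_classProb {k d : ℕ} (x : Fin d → ℝ) (θ : ParamIdx k d → ℝ) :
    ∑ y, classProb x y θ = 1 := by
  simp only [classProb, ← Finset.sum_div]
  exact div_self (sum_exp_logit_pos x θ).ne'

theorem loss_eq {k d : ℕ} (x : Fin d → ℝ) (y : Fin (k + 1)) (θ : ParamIdx k d → ℝ) :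
    loss x y θ = Real.log (∑ y', Real.exp (logit x y' θ)) - logit x y θ := by
  rw [loss, classProb, Real.log_div (Real.exp_pos _).ne' (sum_exp_logit_pos x θ).ne',
    Real.log_exp]
  ring

theorem hasFDerivAt_sum_exp {k d : ℕ} (x : Fin d → ℝ) (θ : ParamIdx k d → ℝ) :
    HasFDerivAt (fun θ => ∑ y, Real.exp (logit (k := k) x y θ))
      (∑ y, Real.exp (logit x y θ) • logitCLM x y) θ :=
  HasFDerivAt.fun_sum fun y _ => (hasFDerivAt_logit x y θ).exp

theorem hasFDerivAt_loss {k d : ℕ} (x : Fin d → ℝ) (y : Fin (k + 1)) (θ : ParamIdx k d → ℝ) :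
    HasFDerivAt (loss x y)
      (∑ y', classProb x y' θ • logitCLM x y' - logitCLM x y) θ := by
  have h := ((hasFDerivAt_sum_exp x θ).log (sum_exp_logit_pos x θ).ne').sub
    (hasFDerivAt_logit x y θ)
  have e : loss x y = (fun θ => Real.log (∑ y', Real.exp (logit x y' θ))) - logit x y :=
    funext fun θ => loss_eq x y θ
  rw [e]
  refine h.congr_fderiv ?_
  rw [Finset.smul_sum]
  congr 1
  refine Finset.sum_congr rfl fun y' _ => ?_
  rw [smul_smul, classProb, div_eq_inv_mul]

theorem lossGrad_apply {k d : ℕ} (x : Fin d → ℝ) (y : Fin (k + 1)) (θ : ParamIdx k d → ℝ)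
    (a : ParamIdx k d) :
    lossGrad x y θ a = ∑ y', classProb x y' θ * logitCLM x y' (Pi.single a 1)
      - logitCLM x y (Pi.single a 1) := by
  rw [lossGrad, (hasFDerivAt_loss x y θ).fderiv]
  simp

theorem hasFDerivAt_classProb {k d : ℕ} (x : Fin d → ℝ) (y : Fin (k + 1))
    (θ : ParamIdx k d → ℝ) :
    HasFDerivAt (classProb x y)
      (classProb x y θ • (logitCLM x y - ∑ y', classProb x y' θ • logitCLM x y')) θ := by
  have e : classProb (k := k) x y = fun θ => Real.exp (-loss x y θ) := by
    funext θ
    have hp : 0 < classProb x y θ := div_pos (Real.exp_pos _) (sum_exp_logit_pos x θ)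
    rw [loss, neg_neg, Real.exp_log hp]
  have h : HasFDerivAt (fun θ => Real.exp (-loss x y θ)) _ θ := (hasFDerivAt_loss x y θ).neg.exp
  rw [← e] at h
  refine h.congr_fderiv ?_
  rw [← neg_sub (logitCLM x y), neg_neg, Pi.neg_apply, ← congrFun e θ]

/-- For every label, the Hessian of the loss is the Fisher information matrix. -/
theorem lossHessian_eq_fisherInfo {k d : ℕ} (x : Fin d → ℝ) (y : Fin (k + 1))
    (θ : ParamIdx k d → ℝ) : lossHessian x y θ = fisherInfo θ x := by
  ext a a'
  have hg : (fun θ' => lossGrad x y θ' a) = fun θ' =>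
      ∑ y', classProb x y' θ' * logitCLM x y' (Pi.single a 1) - logitCLM x y (Pi.single a 1) :=
    funext fun θ' => lossGrad_apply x y θ' a
  have h := (HasFDerivAt.fun_sum (u := Finset.univ) fun y' _ =>
    (hasFDerivAt_classProb x y' θ).mul_const (logitCLM x y' (Pi.single a 1))).sub_const
      (logitCLM x y (Pi.single a 1))
  rw [← hg] at h
  have h1 := sum_classProb x θ
  rw [lossHessian, Matrix.of_apply, h.fderiv, fisherInfo, Matrix.sum_apply]
  simp only [sum_apply, smul_apply, sub_apply, smul_eq_mul, Matrix.smul_apply,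
    Matrix.vecMulVec_apply, lossGrad_apply]
  set m := ∑ y', classProb x y' θ * logitCLM x y' (Pi.single a 1) with hm
  set m' := ∑ y', classProb x y' θ * logitCLM x y' (Pi.single a' 1) with hm'
  have e1 : ∑ y', classProb x y' θ * ((m - logitCLM x y' (Pi.single a 1)) *
      (m' - logitCLM x y' (Pi.single a' 1))) =
      ∑ y', (logitCLM x y' (Pi.single a 1) * (classProb x y' θ *
        (logitCLM x y' (Pi.single a' 1) - m')))
      + m * (m' * ∑ y', classProb x y' θ - m') := by
    rw [hm', mul_sub, Finset.mul_sum, Finset.mul_sum, Finset.mul_sum, ← Finset.sum_sub_distrib,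
      ← Finset.sum_add_distrib]
    refine Finset.sum_congr rfl fun y' _ => ?_
    ring
  rw [e1, h1]
  ring

/-- Closed form: `H(x, θ) = [diag(h) - h hᵀ] ⊗ (x xᵀ)`, where `h` is the vector of the
probabilities of the first `k` classes. -/
theorem fisherInfo_eq_kronecker {k d : ℕ} (x : Fin d → ℝ) (θ : ParamIdx k d → ℝ) :
    fisherInfo θ x = Matrix.kronecker
      (Matrix.diagonal (fun i : Fin k => classProb x i.castSucc θ) -
        Matrix.vecMulVec (fun i : Fin k => classProb x i.castSucc θ)
          (fun i : Fin k => classProb x i.castSucc θ)) (Matrix.vecMulVec x x) := by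
  have hl : ∀ a : ParamIdx k d, logitCLM x (Fin.last k) (Pi.single a 1) = 0 := fun a => by
    simp [logitCLM]
  have hc : ∀ (i : Fin k) (a : ParamIdx k d),
      logitCLM x i.castSucc (Pi.single a 1) = if i = a.1 then x a.2 else 0 := fun i a => by
    obtain ⟨a1, a2⟩ := a
    by_cases h : i = a1 <;> simp [logitCLM, Pi.single_apply, h]
  have h1 := sum_classProb x θ
  rw [Fin.sum_univ_castSucc] at h1
  ext ⟨i, j⟩ ⟨i', j'⟩
  rw [fisherInfo, Matrix.sum_apply]
  simp only [Matrix.smul_apply, Matrix.vecMulVec_apply, lossGrad_apply, smul_eq_mul,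
    Fin.sum_univ_castSucc, hl, hc, Matrix.kronecker, Matrix.kroneckerMap_apply,
    Matrix.sub_apply, Matrix.diagonal_apply]
  simp only [mul_ite, mul_zero, add_zero, sub_zero, Finset.sum_ite_eq', Finset.mem_univ, if_true]
  set q : Fin k → ℝ := fun i => classProb x i.castSucc θ with hq
  have e : ∀ l : Fin k, q l * ((q i * x j - if l = i then x j else 0) *
      (q i' * x j' - if l = i' then x j' else 0)) =
      q l * (q i * x j * (q i' * x j')) - (if l = i then q l * (x j * (q i' * x j')) else 0)
      - (if l = i' then q l * (x j' * (q i * x j)) else 0)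
      + (if l = i then (if l = i' then q l * (x j * x j') else 0) else 0) := fun l => by
    split_ifs <;> ring
  have h2 : classProb x (Fin.last k) θ = 1 - ∑ l, q l := by rw [← h1]; ring
  rw [Finset.sum_congr rfl fun l _ => e l, h2]
  simp only [Finset.sum_add_distrib, Finset.sum_sub_distrib, Finset.sum_ite_eq',
    Finset.mem_univ, if_true, ← Finset.sum_mul]
  change _ = ((if i = i' then q i else 0) - q i * q i') * (x j * x j')
  split_ifs <;> ring

/-! ### The selection problem -/

/-- The inner product `⟨A, B⟩ = Tr(Aᵀ B)`. -/
def minner {n : Type*} [Fintype n] (A B : Matrix n n ℝ) : ℝ :=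
  (A.transpose * B).trace

/-- The matrix `H(x)` of a candidate point, for the batch size `b` and the labelled points `x₀`:
`H(x) = H(x, θ₀) + (1 / b) ∑_{x' ∈ X₀} H(x', θ₀)`. -/
def pointInfo {k d n₀ : ℕ} (b : ℕ) (θ₀ : ParamIdx k d → ℝ) (x₀ : Fin n₀ → Fin d → ℝ)
    (x : Fin d → ℝ) : Matrix (ParamIdx k d) (ParamIdx k d) ℝ :=
  fisherInfo θ₀ x + (1 / (b : ℝ)) • ∑ i, fisherInfo θ₀ (x₀ i)

/-- The objective `f(S) = ⟨S⁻¹, Hp⟩`; it is meant, and used, for positive definite `S` only. -/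
def objective {n : Type*} [Fintype n] [DecidableEq n] (Hp S : Matrix n n ℝ) : ℝ :=
  minner S⁻¹ Hp

/-- `v` is the optimal value `f*` of the selection problem: minimize `f(∑_{i ∈ X} H(x_i))` over
the sets `X` of `b` of the `m` points for which this matrix is positive definite. -/
def IsOptimalValue {n : Type*} [Fintype n] [DecidableEq n] {m : ℕ} (b : ℕ) (Hp : Matrix n n ℝ)
    (H : Fin m → Matrix n n ℝ) (v : ℝ) : Prop :=
  IsLeast {r : ℝ | ∃ X : Finset (Fin m), X.card = b ∧ (∑ i ∈ X, H i).PosDef ∧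
    objective Hp (∑ i ∈ X, H i) = r} v

/-- The domain of the relaxed problem: nonnegative weights of total mass `b` for which the weighted
sum `∑ i, z_i H(x_i)` lies in the domain of `f`, the positive definite matrices. -/
def relaxedDomain {n : Type*} [Fintype n] {m : ℕ} (b : ℕ) (H : Fin m → Matrix n n ℝ) :
    Set (Fin m → ℝ) :=
  {z | (∀ i, 0 ≤ z i) ∧ ∑ i, z i = (b : ℝ) ∧ (∑ i, z i • H i).PosDef}

/-- `z` solves the relaxed problem. -/
def IsRelaxedSolution {n : Type*} [Fintype n] [DecidableEq n] {m : ℕ} (b : ℕ)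
    (Hp : Matrix n n ℝ) (H : Fin m → Matrix n n ℝ) (z : Fin m → ℝ) : Prop :=
  z ∈ relaxedDomain b H ∧
    IsMinOn (fun z' => objective Hp (∑ i, z' i • H i)) (relaxedDomain b H) z

/-! ### The rounding algorithm -/

/-- The whitened matrix `S^{-1/2} H S^{-1/2}`. -/
def whiten {n : Type*} [Fintype n] [DecidableEq n] (S H : Matrix n n ℝ) : Matrix n n ℝ :=
  (CFC.sqrt S)⁻¹ * H * (CFC.sqrt S)⁻¹

/-- The action set `{A : A ⪰ 0, Tr A = 1}`. -/
def actionSet (n : Type*) [Fintype n] : Set (Matrix n n ℝ) :=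
  {A | A.PosSemidef ∧ A.trace = 1}

/-- The `ℓ_{1/2}`-regularizer `w(A) = -2 Tr(A^{1/2})`. -/
def regularizer {n : Type*} [Fintype n] [DecidableEq n] (A : Matrix n n ℝ) : ℝ :=
  -2 * (CFC.sqrt A).trace

/-- The greedy score `Tr[A^{1/2} - (A^{-1/2} + η F)^{-1}]` of the loss matrix `F` at the
action `A`. -/
def greedyScore {n : Type*} [Fintype n] [DecidableEq n] (η : ℝ) (A F : Matrix n n ℝ) : ℝ :=
  (CFC.sqrt A - ((CFC.sqrt A)⁻¹ + η • F)⁻¹).trace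

/-- `A` and `idx` are the actions and the selected indices of a run of the rounding algorithm of
`b` rounds with learning rate `η` on the whitened matrices `F i`, `i < m`. In round `t` the action
`A t` is the follow-the-regularized-leader action for the loss matrices `F (idx s)`, `s < t`,
selected so far, and then an index `idx t` of maximal greedy score among all `m` is selected. -/
structure IsRoundingRun {n : Type*} [Fintype n] [DecidableEq n] {m b : ℕ} (η : ℝ)
    (F : Fin m → Matrix n n ℝ) (A : Fin b → Matrix n n ℝ) (idx : Fin b → Fin m) : Prop where
  action_mem : ∀ t, A t ∈ actionSet n
  action_min : ∀ t, IsMinOn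
    (fun B => η * ∑ s ∈ Finset.univ.filter (fun s => s < t), minner B (F (idx s)) + regularizer B)
    (actionSet n) (A t)
  greedy : ∀ t i, greedyScore η (A t) (F i) ≤ greedyScore η (A t) (F (idx t))

/-- The smallest eigenvalue of a real symmetric matrix (over a nonempty index type). -/
def lambdaMin {n : Type*} [Fintype n] [DecidableEq n] (A : Matrix n n ℝ) : ℝ :=
  sInf (spectrum ℝ A)

end ActiveSelection

end

/-!
Write `N = dk` for the dimension, `F i` for the whitened matrices and `L` for `η` times the sum of
the matrices `F` selected before a given round.

*Duality for the regularizer.* If `c I + L` is positive definite and `A` is an action, then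
`⟨A, L⟩ - 2 Tr A^{1/2} ≥ -c - Tr (c I + L)⁻¹`, since the difference of the two sides is
`Tr (D (c I + L) D) ≥ 0` with `D = A^{1/2} - (c I + L)⁻¹`. Choosing `c` with `Tr (c I + L)⁻² = 1`,
which the intermediate value theorem allows, gives equality at `A = (c I + L)⁻²` and nowhere else.
So the action played satisfies `A^{1/2} = (c I + L)⁻¹` (`exists_dual_certificate`).

*Regret.* After the selection of `F`, the old `c` still certifies a lower bound for the new
regularized problem; compared with the old optimal value it has grown by
`Tr (c I + L)⁻¹ - Tr (c I + L + η F)⁻¹`, the greedy score. The initial optimal value is `-2 √N`.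
Testing the final bound on the rank-one projections `v vᵀ`, whose regularizer is `-2`, shows that
`η vᵀ (∑ F) v ≥ 2 - 2 √N + ∑ scores` for all unit vectors `v`
(`le_dotProduct_sum_of_isRoundingRun`).

*Greedy scores.* With `B = A^{1/2}`, the Woodbury identity gives
`score (F) ≥ η Tr (F B²) / (1 + η Tr (F B))` (`mul_trace_le_mul_trace_sub_inv`). The relaxed weights
`z` satisfy `∑ z i = b` and `∑ z i F i = I`, while `Tr B² = 1` and `Tr B ≤ √N`; averaging over `z`,
the best score is at least `η / (b + η √N)`.

Together `∑ F ≥ (1 / (1 + η √N / b) - 2 √N / η) I`, and the choice of `η` and the bound on `b` make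
this at least `(1 + ε)⁻¹ I`. Undoing the whitening, the selected sum is at least `(1 + ε)⁻¹` times
the relaxed optimum. Inversion is antitone and `H_p` is positive semidefinite, so the objective is at
most `1 + ε` times the relaxed optimal value, which is at most `f*` because the indicator of a set
of `b` points is a feasible weight.
-/

open scoped MatrixOrder

namespace ActiveSelection

open Matrix

/-! ### Positive semidefinite real matrices -/

section Matrices

variable {n : Type*} [Fintype n] [DecidableEq n]

theorem exists_unitary_diagonal {A : Matrix n n ℝ} (hA : A.IsHermitian) :
    ∃ U : Matrix n n ℝ, Uᴴ * U = 1 ∧ U * Uᴴ = 1 ∧ A = U * diagonal hA.eigenvalues * Uᴴ := by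
  refine ⟨hA.eigenvectorUnitary, ?_, ?_, ?_⟩
  · exact Unitary.coe_star_mul_self hA.eigenvectorUnitary
  · exact Unitary.coe_mul_star_self hA.eigenvectorUnitary
  · have h := hA.spectral_theorem
    rw [Unitary.conjStarAlgAut_apply] at h
    exact h

theorem posSemidef_trace_smul_one_sub {P : Matrix n n ℝ} (hP : P.PosSemidef) :
    (P.trace • (1 : Matrix n n ℝ) - P).PosSemidef := by
  obtain ⟨U, -, hU, hA⟩ := exists_unitary_diagonal hP.isHermitian
  have h : P.trace • (1 : Matrix n n ℝ) - P =
      U * diagonal (fun i => P.trace - hP.isHermitian.eigenvalues i) * Uᴴ := by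
    have h1 : diagonal (fun i => P.trace - hP.isHermitian.eigenvalues i) =
        P.trace • (1 : Matrix n n ℝ) - diagonal hP.isHermitian.eigenvalues := by
      ext i j
      by_cases hij : i = j <;> simp [hij]
    rw [h1, mul_sub, sub_mul, ← hA, mul_smul_comm, smul_mul_assoc, mul_one, hU]
  rw [h]
  refine PosSemidef.mul_mul_conjTranspose_same (PosSemidef.diagonal fun i => ?_) U
  have ht := hP.isHermitian.trace_eq_sum_eigenvalues
  rw [Pi.zero_apply, sub_nonneg, ht]
  exact Finset.single_le_sum (f := fun i => hP.isHermitian.eigenvalues i)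
    (fun j _ => hP.eigenvalues_nonneg j) (Finset.mem_univ i)

theorem trace_mul_nonneg {A B : Matrix n n ℝ} (hA : A.PosSemidef) (hB : B.PosSemidef) :
    0 ≤ (A * B).trace := by
  obtain ⟨C, rfl⟩ := CStarAlgebra.nonneg_iff_eq_star_mul_self.mp hA.nonneg
  rw [mul_assoc, trace_mul_comm]
  exact (hB.mul_mul_conjTranspose_same C).trace_nonneg

theorem posDef_mul_inv {A : Matrix n n ℝ} (hA : A.PosDef) : A * A⁻¹ = 1 :=
  mul_nonsing_inv _ ((isUnit_iff_isUnit_det _).mp hA.isUnit)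

theorem posDef_inv_mul {A : Matrix n n ℝ} (hA : A.PosDef) : A⁻¹ * A = 1 :=
  nonsing_inv_mul _ ((isUnit_iff_isUnit_det _).mp hA.isUnit)

/-- Matrix inversion is antitone on positive definite matrices: `P⁻¹ - Q⁻¹` is the sum of the two
congruences `(P⁻¹ - Q⁻¹) P (P⁻¹ - Q⁻¹)` and `Q⁻¹ (Q - P) Q⁻¹`. -/
theorem posSemidef_inv_sub_inv {P Q : Matrix n n ℝ} (hP : P.PosDef) (hQ : Q.PosDef)
    (h : (Q - P).PosSemidef) : (P⁻¹ - Q⁻¹).PosSemidef := by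
  have h1 := hP.posSemidef.conjTranspose_mul_mul_same (P⁻¹ - Q⁻¹)
  have h2 := h.conjTranspose_mul_mul_same Q⁻¹
  have e : P⁻¹ - Q⁻¹ = (P⁻¹ - Q⁻¹)ᴴ * P * (P⁻¹ - Q⁻¹) + (Q⁻¹)ᴴ * (Q - P) * Q⁻¹ := by
    rw [conjTranspose_sub, hP.inv.isHermitian.eq, hQ.inv.isHermitian.eq, sub_mul,
      posDef_inv_mul hP, mul_sub, sub_mul, sub_mul, mul_sub, mul_assoc _ P P⁻¹,
      posDef_mul_inv hP, sub_mul _ _ Q⁻¹, posDef_inv_mul hQ]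
    simp only [one_mul, mul_one]
    abel
  rw [e]
  exact h1.add h2

theorem posSemidef_sqrt (A : Matrix n n ℝ) : (CFC.sqrt A).PosSemidef :=
  nonneg_iff_posSemidef.mp (CFC.sqrt_nonneg A)

theorem sqrt_mul_self_of_posSemidef {A : Matrix n n ℝ} (hA : A.PosSemidef) :
    CFC.sqrt A * CFC.sqrt A = A :=
  CFC.sqrt_mul_sqrt_self A hA.nonneg

theorem posDef_sqrt {A : Matrix n n ℝ} (hA : A.PosDef) : (CFC.sqrt A).PosDef := by
  rw [(posSemidef_sqrt A).posDef_iff_det_ne_zero]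
  intro h
  have h1 := congrArg Matrix.det (sqrt_mul_self_of_posSemidef hA.posSemidef)
  rw [det_mul, h, zero_mul] at h1
  exact hA.det_pos.ne h1

end Matrices

/-! ### Duality for the regularized problem -/

section Regularizer

theorem minner_eq_trace_mul {n : Type*} [Fintype n] {A B : Matrix n n ℝ} (hA : A.IsHermitian) :
    minner A B = (A * B).trace := by
  rw [minner, ← conjTranspose_eq_transpose_of_trivial, hA.eq]

variable {n : Type*} [Fintype n] [DecidableEq n]

/-- The duality gap between an action `A` and a dual certificate `M` is a weighted square of
`A^{1/2} - M⁻¹`. -/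
theorem trace_mul_sub_sqrt_add_inv {A M : Matrix n n ℝ} (hA : A.PosSemidef) (hM : M.PosDef) :
    (A * M).trace - 2 * (CFC.sqrt A).trace + M⁻¹.trace =
      ((CFC.sqrt A - M⁻¹)ᴴ * M * (CFC.sqrt A - M⁻¹)).trace := by
  set R := CFC.sqrt A with hR
  have hRR : R * R = A := sqrt_mul_self_of_posSemidef hA
  have e : (R - M⁻¹)ᴴ * M * (R - M⁻¹) = R * M * R - R - R + M⁻¹ := by
    rw [conjTranspose_sub, (posSemidef_sqrt A).isHermitian.eq, hM.inv.isHermitian.eq, sub_mul,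
      posDef_inv_mul hM, mul_sub, sub_mul, sub_mul, mul_assoc R M M⁻¹, posDef_mul_inv hM]
    simp only [one_mul, mul_one]
    abel
  rw [e, trace_add, trace_sub, trace_sub, trace_mul_cycle, hRR]
  ring

theorem duality_gap_nonneg {A M : Matrix n n ℝ} (hA : A.PosSemidef) (hM : M.PosDef) :
    0 ≤ (A * M).trace - 2 * (CFC.sqrt A).trace + M⁻¹.trace := by
  rw [trace_mul_sub_sqrt_add_inv hA hM]
  exact (hM.posSemidef.conjTranspose_mul_mul_same _).trace_nonneg

theorem sqrt_eq_inv_of_duality_gap_nonpos {A M : Matrix n n ℝ} (hA : A.PosSemidef)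
    (hM : M.PosDef) (h : (A * M).trace - 2 * (CFC.sqrt A).trace + M⁻¹.trace ≤ 0) :
    CFC.sqrt A = M⁻¹ := by
  have h0 := le_antisymm h (duality_gap_nonneg hA hM)
  rw [trace_mul_sub_sqrt_add_inv hA hM,
    (hM.posSemidef.conjTranspose_mul_mul_same _).trace_eq_zero_iff] at h0
  -- factor `M = Cᴴ C`, so that a vanishing congruence of `M` forces `C (A^{1/2} - M⁻¹) = 0`
  obtain ⟨C, hC⟩ := CStarAlgebra.nonneg_iff_eq_star_mul_self.mp hM.posSemidef.nonneg
  rw [star_eq_conjTranspose] at hC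
  have h1 : C * (CFC.sqrt A - M⁻¹) = 0 := by
    rw [← conjTranspose_mul_self_eq_zero, conjTranspose_mul, ← h0, hC]
    simp only [mul_assoc]
  have h2 : M⁻¹ * (M * (CFC.sqrt A - M⁻¹)) = 0 := by
    have h3 : M * (CFC.sqrt A - M⁻¹) = Cᴴ * (C * (CFC.sqrt A - M⁻¹)) := by
      rw [← mul_assoc, ← hC]
    rw [h3, h1, mul_zero, mul_zero]
  rw [← mul_assoc, posDef_inv_mul hM, one_mul] at h2
  exact sub_eq_zero.mp h2

theorem trace_mul_smul_one_add {A L : Matrix n n ℝ} (hA : A ∈ actionSet n) (c : ℝ) :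
    (A * (c • (1 : Matrix n n ℝ) + L)).trace = c + minner A L := by
  rw [minner_eq_trace_mul hA.1.isHermitian, mul_add, trace_add, mul_smul_comm, mul_one,
    trace_smul, hA.2, smul_eq_mul, mul_one]

/-- Weak duality for the regularized linear objective on the action set: every `c` for which
`c I + L` is positive definite certifies the lower bound `-c - Tr (c I + L)⁻¹`. -/
theorem neg_sub_trace_inv_le {B L : Matrix n n ℝ} (hB : B ∈ actionSet n) {c : ℝ}
    (hM : (c • (1 : Matrix n n ℝ) + L).PosDef) :
    -c - (c • (1 : Matrix n n ℝ) + L)⁻¹.trace ≤ minner B L + regularizer B := by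
  have h := duality_gap_nonneg hB.1 hM
  rw [trace_mul_smul_one_add hB] at h
  rw [regularizer]
  linarith

/-- The dual optimality condition `Tr (c I + L)⁻² = 1` has a solution: along the eigenvalues it is
an equation `∑ (c + μᵢ)⁻² = 1`, whose left side is at least `1` at `c = 1 - min μ` and at most `1`
at `c = √(card n) - min μ`. -/
theorem exists_posDef_trace_inv_sq_eq_one [Nonempty n] {L : Matrix n n ℝ} (hL : L.IsHermitian) :
    ∃ c : ℝ, (c • (1 : Matrix n n ℝ) + L).PosDef ∧
      ((c • (1 : Matrix n n ℝ) + L)⁻¹ * (c • (1 : Matrix n n ℝ) + L)⁻¹).trace = 1 := by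
  obtain ⟨U, hU', hU, hA⟩ := exists_unitary_diagonal hL
  set μ := hL.eigenvalues with hμ
  obtain ⟨i₀, hi₀⟩ := Finite.exists_min μ
  have hN1 : (1 : ℝ) ≤ Fintype.card n := by exact_mod_cast Fintype.card_pos
  have hN : 1 ≤ Real.sqrt (Fintype.card n) := Real.one_le_sqrt.mpr hN1
  have hpos : ∀ c ∈ Set.Icc (1 - μ i₀) (Real.sqrt (Fintype.card n) - μ i₀), ∀ i, 0 < c + μ i := by
    intro c hc i
    linarith [hc.1, hi₀ i]
  have hcont : ContinuousOn (fun c : ℝ => ∑ i, (c + μ i)⁻¹ * (c + μ i)⁻¹)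
      (Set.Icc (1 - μ i₀) (Real.sqrt (Fintype.card n) - μ i₀)) := by
    have h1 : ∀ i, ContinuousOn (fun c : ℝ => (c + μ i)⁻¹)
        (Set.Icc (1 - μ i₀) (Real.sqrt (Fintype.card n) - μ i₀)) := fun i =>
      (by fun_prop : ContinuousOn (fun c : ℝ => c + μ i) _).inv₀ fun c hc => (hpos c hc i).ne'
    exact continuousOn_finsetSum _ fun i _ => (h1 i).mul (h1 i)
  obtain ⟨c, hc, hc1⟩ := intermediate_value_Icc' (sub_le_sub_right hN _) hcont
    (show (1 : ℝ) ∈ _ from ⟨by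
      have h : ∀ i ∈ Finset.univ, (Real.sqrt (Fintype.card n) - μ i₀ + μ i)⁻¹ *
          (Real.sqrt (Fintype.card n) - μ i₀ + μ i)⁻¹ ≤ (Fintype.card n : ℝ)⁻¹ := fun i _ => by
        rw [← mul_inv]
        refine inv_anti₀ (by linarith) ?_
        nlinarith [hi₀ i, Real.mul_self_sqrt (zero_le_one.trans hN1)]
      refine (Finset.sum_le_sum h).trans ?_
      rw [Finset.sum_const, Finset.card_univ, nsmul_eq_mul, mul_inv_cancel₀ (by linarith)], by
      have h := Finset.single_le_sum
        (f := fun i => (1 - μ i₀ + μ i)⁻¹ * (1 - μ i₀ + μ i)⁻¹)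
        (fun i _ => mul_self_nonneg _) (Finset.mem_univ i₀)
      simpa using h⟩)
  have e : c • (1 : Matrix n n ℝ) + L = U * diagonal (fun i => c + μ i) * Uᴴ := by
    have h1 : diagonal (fun i => c + μ i) = c • (1 : Matrix n n ℝ) + diagonal μ := by
      ext i j
      by_cases hij : i = j <;> simp [hij]
    rw [h1, mul_add, add_mul, ← hA, mul_smul_comm, smul_mul_assoc, mul_one, hU]
  have hinj : Function.Injective Uᴴ.mulVec :=
    mulVec_injective_of_isUnit (IsUnit.of_mul_eq_one _ hU')
  have einv : (c • (1 : Matrix n n ℝ) + L)⁻¹ = U * diagonal (fun i => (c + μ i)⁻¹) * Uᴴ := by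
    refine inv_eq_right_inv ?_
    have hd : diagonal (fun i => c + μ i) * diagonal (fun i => (c + μ i)⁻¹) = 1 := by
      rw [diagonal_mul_diagonal, ← diagonal_one]
      congr 1
      exact funext fun i => mul_inv_cancel₀ (hpos c hc i).ne'
    calc _ = U * diagonal (fun i => c + μ i) * (Uᴴ * U) * diagonal (fun i => (c + μ i)⁻¹) * Uᴴ := by
          rw [e]
          simp only [mul_assoc]
      _ = 1 := by rw [hU', mul_one, mul_assoc U, hd, mul_one, hU]
  refine ⟨c, ?_, ?_⟩
  · rw [e]
    have h := (PosDef.diagonal (R := ℝ) (hpos c hc)).conjTranspose_mul_mul_same hinj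
    rwa [conjTranspose_conjTranspose] at h
  · rw [einv]
    calc _ = (U * (diagonal (fun i => (c + μ i)⁻¹) * (Uᴴ * U) *
            diagonal (fun i => (c + μ i)⁻¹)) * Uᴴ).trace := by simp only [mul_assoc]
      _ = 1 := by
        rw [hU', mul_one, diagonal_mul_diagonal, trace_mul_cycle, hU', one_mul, trace_diagonal]
        exact hc1

/-- The follow-the-regularized-leader action is `(c I + L)⁻²` for a suitable `c`, and it closes the
duality gap. -/
theorem exists_dual_certificate [Nonempty n] {A L : Matrix n n ℝ} (hL : L.IsHermitian)
    (hA : A ∈ actionSet n)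
    (hmin : IsMinOn (fun B => minner B L + regularizer B) (actionSet n) A) :
    ∃ c : ℝ, (c • (1 : Matrix n n ℝ) + L).PosDef ∧
      CFC.sqrt A = (c • (1 : Matrix n n ℝ) + L)⁻¹ ∧
      minner A L + regularizer A = -c - (c • (1 : Matrix n n ℝ) + L)⁻¹.trace := by
  obtain ⟨c, hM, hc⟩ := exists_posDef_trace_inv_sq_eq_one hL
  set M := c • (1 : Matrix n n ℝ) + L with hMdef
  -- the action `M⁻²` attains the dual value, so the minimizer `A` has no duality gap
  have hB : M⁻¹ * M⁻¹ ∈ actionSet n := by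
    refine ⟨?_, hc⟩
    have h := posSemidef_conjTranspose_mul_self M⁻¹
    rwa [hM.inv.isHermitian.eq] at h
  have hBs : CFC.sqrt (M⁻¹ * M⁻¹) = M⁻¹ := CFC.sqrt_mul_self _ hM.inv.posSemidef.nonneg
  have hle : minner A L + regularizer A ≤ -c - M⁻¹.trace := by
    refine (hmin hB).trans (le_of_eq ?_)
    have h := trace_mul_smul_one_add (L := L) hB c
    rw [← hMdef, mul_assoc, posDef_inv_mul hM, mul_one] at h
    simp only [regularizer, hBs]
    linarith
  refine ⟨c, hM, sqrt_eq_inv_of_duality_gap_nonpos hA.1 hM ?_,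
    le_antisymm hle (neg_sub_trace_inv_le hA hM)⟩
  have h : (A * M).trace = c + minner A L := trace_mul_smul_one_add hA c
  rw [regularizer] at hle
  linarith

end Regularizer

/-! ### The greedy score and the regret bound -/

section Greedy

variable {n : Type*} [Fintype n] [DecidableEq n]

/-- With `K = I + η F^{1/2} B F^{1/2}`, the Woodbury identity gives
`B - (B⁻¹ + η F)⁻¹ = η B F^{1/2} K⁻¹ F^{1/2} B`, and `K ≤ (1 + η Tr (F B)) I`. -/
theorem mul_trace_le_mul_trace_sub_inv {B F : Matrix n n ℝ} (hB : B.PosDef) (hF : F.PosSemidef)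
    {η : ℝ} (hη : 0 < η) :
    η * (F * (B * B)).trace ≤
      (1 + η * (F * B).trace) * (B - (B⁻¹ + η • F)⁻¹).trace := by
  set W := CFC.sqrt F with hW
  have hWh : Wᴴ = W := (posSemidef_sqrt F).isHermitian.eq
  have hWW : W * W = F := sqrt_mul_self_of_posSemidef hF
  have hBB : B⁻¹⁻¹ = B := nonsing_inv_nonsing_inv _ ((isUnit_iff_isUnit_det _).mp hB.isUnit)
  set P := W * B * W with hPdef
  have hP : P.PosSemidef := by
    have h := hB.posSemidef.conjTranspose_mul_mul_same W
    rwa [hWh] at h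
  have hPt : P.trace = (F * B).trace := by
    rw [hPdef, trace_mul_cycle, hWW]
  set K := 1 + η • P with hKdef
  have hK : K.PosDef := PosDef.one.add_posSemidef (hP.smul hη.le)
  set τ := 1 + η * (F * B).trace with hτ
  have hτ0 : 0 < τ := by
    have := trace_mul_nonneg hF hB.posSemidef
    positivity
  have hKτ : (τ • (1 : Matrix n n ℝ) - K).PosSemidef := by
    have h := (posSemidef_trace_smul_one_sub hP).smul hη.le
    have e : τ • (1 : Matrix n n ℝ) - K = η • (P.trace • (1 : Matrix n n ℝ) - P) := by
      rw [hKdef, hτ, ← hPt, smul_sub, smul_smul, add_smul, one_smul]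
      abel
    rwa [e]
  have hKinv := posSemidef_inv_sub_inv hK (PosDef.one.smul hτ0) hKτ
  have hτinv : (τ • (1 : Matrix n n ℝ))⁻¹ = τ⁻¹ • (1 : Matrix n n ℝ) := by
    refine inv_eq_right_inv ?_
    rw [smul_mul_smul_comm, mul_one, mul_inv_cancel₀ hτ0.ne', one_smul]
  rw [hτinv] at hKinv
  have hwood : B - (B⁻¹ + η • F)⁻¹ = η • ((W * B)ᴴ * K⁻¹ * (W * B)) := by
    have e : B⁻¹ + η • F = B⁻¹ + (η • W) * 1 * W := by
      rw [mul_one, smul_mul_assoc, hWW]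
    have hC : (1 : Matrix n n ℝ)⁻¹ + W * B⁻¹⁻¹ * (η • W) = K := by
      rw [inv_one, hBB, mul_smul_comm]
    rw [e, add_mul_mul_inv_eq_sub _ _ _ _ hB.inv.isUnit isUnit_one (hC ▸ hK.isUnit), hC, hBB,
      sub_sub_cancel, conjTranspose_mul, hWh, hB.isHermitian.eq]
    simp only [mul_smul_comm, smul_mul_assoc, mul_assoc]
  have h := (hKinv.conjTranspose_mul_mul_same (W * B)).trace_nonneg
  have e2 : ((W * B)ᴴ * (τ⁻¹ • 1) * (W * B)).trace = τ⁻¹ * (F * (B * B)).trace := by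
    rw [mul_smul_comm, smul_mul_assoc, trace_smul, smul_eq_mul, mul_one, conjTranspose_mul, hWh,
      hB.isHermitian.eq, mul_assoc, ← mul_assoc W W B, hWW, trace_mul_comm, mul_assoc]
  rw [mul_sub, sub_mul, trace_sub, e2, sub_nonneg] at h
  rw [hwood, trace_smul, smul_eq_mul]
  calc η * (F * (B * B)).trace = η * τ * (τ⁻¹ * (F * (B * B)).trace) := by
        field_simp
    _ ≤ η * τ * ((W * B)ᴴ * K⁻¹ * (W * B)).trace :=
        mul_le_mul_of_nonneg_left h (by positivity)
    _ = _ := by ring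

/-- `(Tr B)² ≤ card n * Tr B²`, here with `Tr B² = 1`. -/
theorem trace_le_sqrt_card {B : Matrix n n ℝ} (hB : B.PosSemidef) (h1 : (B * B).trace = 1) :
    B.trace ≤ Real.sqrt (Fintype.card n) := by
  rcases isEmpty_or_nonempty n with hn | hn
  · simp [Matrix.trace]
  have hN : 0 < Real.sqrt (Fintype.card n) :=
    Real.sqrt_pos.mpr (by exact_mod_cast Fintype.card_pos)
  set r := Real.sqrt (Fintype.card n) with hr
  have hrr : r * r = Fintype.card n := Real.mul_self_sqrt (by positivity)
  -- expand `0 ≤ Tr (r B - I)²`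
  have h := (posSemidef_conjTranspose_mul_self (r • B - 1)).trace_nonneg
  have e : (r • B - 1)ᴴ * (r • B - 1) = (r * r) • (B * B) - r • B - r • B + 1 := by
    rw [conjTranspose_sub, conjTranspose_smul, hB.isHermitian.eq, conjTranspose_one, star_trivial,
      sub_mul, mul_sub, smul_mul_smul_comm, mul_one, one_mul]
    abel
  rw [e, trace_add, trace_sub, trace_sub, trace_smul, trace_smul, h1, trace_one, ← hrr] at h
  simp only [smul_eq_mul] at h
  nlinarith

/-- If the loss matrices average to a multiple of the identity, some loss matrix has a large greedy
score, hence so does the greedy one. -/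
theorem div_le_of_forall_greedyScore_le {m : ℕ} {b η s : ℝ} (hb : 0 < b) (hη : 0 < η)
    {F : Fin m → Matrix n n ℝ} (hF : ∀ i, (F i).PosSemidef) {z : Fin m → ℝ} (hz : ∀ i, 0 ≤ z i)
    (hzb : ∑ i, z i = b) (hzF : ∑ i, z i • F i = 1) {A : Matrix n n ℝ} (hA : A ∈ actionSet n)
    (hAs : (CFC.sqrt A).PosDef) (hs : ∀ i, greedyScore η A (F i) ≤ s) :
    η / (b + η * Real.sqrt (Fintype.card n)) ≤ s := by
  set B := CFC.sqrt A with hBdef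
  have hBB : B * B = A := sqrt_mul_self_of_posSemidef hA.1
  have hlin : ∀ X : Matrix n n ℝ, ∑ i, z i * (F i * X).trace = X.trace := fun X => by
    have h : (∑ i, z i • F i) * X = X := by rw [hzF, one_mul]
    conv_rhs => rw [← h, Finset.sum_mul, trace_sum]
    exact Finset.sum_congr rfl fun i _ => by rw [smul_mul_assoc, trace_smul, smul_eq_mul]
  have hnn : ∀ i, 0 ≤ (F i * B).trace := fun i => trace_mul_nonneg (hF i) hAs.posSemidef
  have hi : ∀ i, z i * (η * (F i * A).trace) ≤ z i * ((1 + η * (F i * B).trace) * s) := fun i => by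
    have h := mul_trace_le_mul_trace_sub_inv hAs (hF i) hη
    rw [hBB] at h
    exact mul_le_mul_of_nonneg_left
      (h.trans (mul_le_mul_of_nonneg_left (hs i) (by have := hnn i; positivity))) (hz i)
  have hsum := Finset.sum_le_sum fun i (_ : i ∈ Finset.univ) => hi i
  have e1 : ∑ i, z i * (η * (F i * A).trace) = η := by
    rw [Finset.sum_congr rfl fun i _ => mul_left_comm (z i) η _, ← Finset.mul_sum, hlin, hA.2,
      mul_one]
  have e2 : ∑ i, z i * ((1 + η * (F i * B).trace) * s) = (b + η * B.trace) * s := by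
    rw [← hzb, ← hlin B, Finset.mul_sum, ← Finset.sum_add_distrib, Finset.sum_mul]
    exact Finset.sum_congr rfl fun i _ => by ring
  rw [e1, e2] at hsum
  have hB0 := hAs.posSemidef.trace_nonneg
  have hpos : 0 < b + η * B.trace := by positivity
  have hs0 : 0 ≤ s := nonneg_of_mul_nonneg_right (hη.le.trans hsum) hpos
  rw [div_le_iff₀ (by positivity)]
  have hBn : B.trace ≤ Real.sqrt (Fintype.card n) :=
    trace_le_sqrt_card hAs.posSemidef (by rw [hBB, hA.2])
  have : η * B.trace ≤ η * Real.sqrt (Fintype.card n) := mul_le_mul_of_nonneg_left hBn hη.le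
  nlinarith

/-- The regret bound in potential form: after `j` rounds, the regularized cumulative loss of every
action is at least `-2 √(card n)`, its minimum before the first round, plus the greedy scores
collected. In one round the dual certificate `c` of the action played stays feasible, and its dual
value grows by exactly the greedy score. -/
theorem le_regularized_loss_of_isRoundingRun [Nonempty n] {m b : ℕ} {η : ℝ} (hη : 0 < η)
    {F : Fin m → Matrix n n ℝ} (hF : ∀ i, (F i).PosSemidef) {A : Fin b → Matrix n n ℝ}
    {idx : Fin b → Fin m} (hrun : IsRoundingRun η F A idx) {γ : ℝ}
    (hγ : ∀ t, (CFC.sqrt (A t)).PosDef → γ ≤ greedyScore η (A t) (F (idx t))) {j : ℕ}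
    (hj : j ≤ b) {B : Matrix n n ℝ} (hB : B ∈ actionSet n) :
    -2 * Real.sqrt (Fintype.card n) + j * γ ≤
      minner B (η • ∑ s ∈ Finset.univ.filter (fun s : Fin b => (s : ℕ) < j), F (idx s)) +
        regularizer B := by
  induction j generalizing B with
  | zero =>
    -- the certificate `c = √(card n)` for `L = 0`
    have hN : 0 < Real.sqrt (Fintype.card n) :=
      Real.sqrt_pos.mpr (by exact_mod_cast Fintype.card_pos)
    set r := Real.sqrt (Fintype.card n) with hr
    have hrr : r * r = Fintype.card n := Real.mul_self_sqrt (by positivity)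
    have hinv : (r • (1 : Matrix n n ℝ))⁻¹ = r⁻¹ • (1 : Matrix n n ℝ) := by
      refine inv_eq_right_inv ?_
      rw [smul_mul_smul_comm, mul_one, mul_inv_cancel₀ hN.ne', one_smul]
    have h := neg_sub_trace_inv_le (L := 0) hB (c := r)
      (by rw [add_zero]; exact PosDef.one.smul hN)
    rw [add_zero, hinv, trace_smul, trace_one, ← hrr, smul_eq_mul,
      inv_mul_cancel_left₀ hN.ne'] at h
    simp only [not_lt_zero, Finset.filter_false, Finset.sum_empty, smul_zero, Nat.cast_zero,
      zero_mul, add_zero]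
    linarith
  | succ j ih =>
    have hjb : j < b := hj
    set t : Fin b := ⟨j, hjb⟩ with ht
    set L := η • ∑ s ∈ Finset.univ.filter (fun s : Fin b => (s : ℕ) < j), F (idx s) with hL
    have hLh : L.IsHermitian :=
      ((posSemidef_sum _ fun s _ => hF (idx s)).smul hη.le).isHermitian
    have hstep : η • ∑ s ∈ Finset.univ.filter (fun s : Fin b => (s : ℕ) < j + 1), F (idx s) =
        L + η • F (idx t) := by
      have hf : Finset.univ.filter (fun s : Fin b => (s : ℕ) < j + 1) =
          insert t (Finset.univ.filter (fun s : Fin b => (s : ℕ) < j)) := by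
        ext s
        simp only [Finset.mem_filter, Finset.mem_univ, true_and, Finset.mem_insert, ht, Fin.ext_iff]
        omega
      rw [hf, Finset.sum_insert (by simp [ht]), smul_add, add_comm]
    have hmin : IsMinOn (fun B => minner B L + regularizer B) (actionSet n) (A t) := by
      have h := hrun.action_min t
      have e : (fun B : Matrix n n ℝ => minner B L + regularizer B) =
          fun B => η * ∑ s ∈ Finset.univ.filter (fun s => s < t), minner B (F (idx s)) +
            regularizer B := by
        funext B
        simp only [hL, minner, mul_smul_comm, trace_smul, Finset.mul_sum, trace_sum, smul_eq_mul,
          Finset.smul_sum, Fin.lt_def, ht]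
      rwa [e]
    obtain ⟨c, hM, hsqrt, hval⟩ := exists_dual_certificate hLh (hrun.action_mem t) hmin
    have hM' : (c • (1 : Matrix n n ℝ) + (L + η • F (idx t))).PosDef := by
      rw [← add_assoc]
      exact hM.add_posSemidef ((hF _).smul hη.le)
    have h1 := neg_sub_trace_inv_le hB hM'
    have h2 := ih hjb.le (hrun.action_mem t)
    have h3 := hγ t (hsqrt ▸ hM.inv)
    have hMM := nonsing_inv_nonsing_inv _ ((isUnit_iff_isUnit_det _).mp hM.isUnit)
    rw [greedyScore, hsqrt, hMM, trace_sub, add_assoc] at h3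
    rw [hstep]
    push_cast
    linarith

/-- Testing the regret bound against the rank-one actions, whose regularizer is `-2`, bounds the
cumulative loss matrix from below. -/
theorem le_dotProduct_sum_of_isRoundingRun [Nonempty n] {m b : ℕ} {η : ℝ} (hη : 0 < η)
    {F : Fin m → Matrix n n ℝ} (hF : ∀ i, (F i).PosSemidef) {A : Fin b → Matrix n n ℝ}
    {idx : Fin b → Fin m} (hrun : IsRoundingRun η F A idx) {γ : ℝ}
    (hγ : ∀ t, (CFC.sqrt (A t)).PosDef → γ ≤ greedyScore η (A t) (F (idx t))) (v : n → ℝ) :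
    (2 - 2 * Real.sqrt (Fintype.card n) + b * γ) * (v ⬝ᵥ v) ≤
      η * (v ⬝ᵥ ((∑ t, F (idx t)) *ᵥ v)) := by
  rcases eq_or_ne v 0 with rfl | hv
  · simp
  have hq : 0 < v ⬝ᵥ v := by
    have := dotProduct_star_self_pos_iff.mpr hv
    rwa [star_trivial] at this
  set q := v ⬝ᵥ v with hqdef
  -- the orthogonal projection onto `v`, which is its own square root
  set B := q⁻¹ • vecMulVec v v with hBdef
  have hBpsd : B.PosSemidef := by
    have h := posSemidef_vecMulVec_self_star v
    rw [star_trivial] at h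
    exact h.smul (inv_nonneg.mpr hq.le)
  have hBt : B.trace = 1 := by
    rw [hBdef, trace_smul, trace_vecMulVec, smul_eq_mul, inv_mul_cancel₀ hq.ne']
  have hBB : B * B = B := by
    rw [hBdef, smul_mul_smul_comm, vecMulVec_mul_vecMulVec, ← hqdef, vecMulVec_smul, smul_smul,
      mul_assoc, inv_mul_cancel₀ hq.ne', mul_one]
  have h := le_regularized_loss_of_isRoundingRun hη hF hrun hγ le_rfl ⟨hBpsd, hBt⟩
  have hall : Finset.univ.filter (fun s : Fin b => (s : ℕ) < b) = Finset.univ :=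
    Finset.filter_true_of_mem fun s _ => s.isLt
  have hsq : CFC.sqrt B = B := CFC.sqrt_unique hBB hBpsd.nonneg
  rw [hall, regularizer, hsq, hBt, minner_eq_trace_mul hBpsd.isHermitian, hBdef, smul_mul_assoc,
    trace_smul, mul_smul_comm, trace_smul, vecMulVec_mul, trace_vecMulVec, dotProduct_comm,
    ← dotProduct_mulVec, smul_eq_mul, smul_eq_mul] at h
  have h2 := mul_le_mul_of_nonneg_right h hq.le
  have e : (q⁻¹ * (η * (v ⬝ᵥ ((∑ t, F (idx t)) *ᵥ v))) + -2 * 1) * q =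
      η * (v ⬝ᵥ ((∑ t, F (idx t)) *ᵥ v)) - 2 * q := by
    field_simp
    ring
  rw [e] at h2
  linarith

/-- With `η = 8 √N / ε` and `N = card n`, the regret term `2 √N / η` equals `ε / 4` and
`η √N / b ≤ ε / 4`, so that the cumulative loss matrix is at least
`1 / (1 + ε / 4) - ε / 4 ≥ 1 / (1 + ε)`. -/
theorem posSemidef_sum_sub_of_isRoundingRun [Nonempty n] {m b : ℕ} {ε : ℝ} (hε₀ : 0 < ε)
    (hε₁ : ε < 1)
    (hb : 32 * (Fintype.card n : ℝ) / ε ^ 2 + 16 * Real.sqrt (Fintype.card n) / ε ^ 2 ≤ b)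
    {F : Fin m → Matrix n n ℝ} (hF : ∀ i, (F i).PosSemidef) {z : Fin m → ℝ} (hz : ∀ i, 0 ≤ z i)
    (hzb : ∑ i, z i = b) (hzF : ∑ i, z i • F i = 1) {A : Fin b → Matrix n n ℝ}
    {idx : Fin b → Fin m}
    (hrun : IsRoundingRun (8 * Real.sqrt (Fintype.card n) / ε) F A idx) :
    (∑ t, F (idx t) - (1 / (1 + ε)) • (1 : Matrix n n ℝ)).PosSemidef := by
  have hN1 : (1 : ℝ) ≤ Fintype.card n := by exact_mod_cast Fintype.card_pos
  set N : ℝ := (Fintype.card n : ℝ)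
  set r := Real.sqrt N with hr
  have hr0 : 0 < r := Real.sqrt_pos.mpr (by linarith)
  have hrr : r * r = N := Real.mul_self_sqrt (by linarith)
  set η := 8 * r / ε with hηdef
  have hη : 0 < η := by positivity
  have hb0 : (0 : ℝ) < b := lt_of_lt_of_le (by positivity) hb
  have hγ : ∀ t, (CFC.sqrt (A t)).PosDef →
      η / (b + η * r) ≤ greedyScore η (A t) (F (idx t)) := fun t ht =>
    div_le_of_forall_greedyScore_le hb0 hη hF hz hzb hzF (hrun.action_mem t) ht (hrun.greedy t)
  have hnum : η * (1 / (1 + ε)) ≤ 2 - 2 * r + b * (η / (b + η * r)) := by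
    have h1 : η * r ≤ ε / 4 * b := by
      have h0 : 0 ≤ 16 * r / ε ^ 2 := by positivity
      have h2 : 32 * N / ε ^ 2 ≤ b := by linarith
      have e : η * r = ε / 4 * (32 * N / ε ^ 2) := by
        rw [hηdef, ← hrr]
        field_simp
        ring
      rw [e]
      exact mul_le_mul_of_nonneg_left h2 (by positivity)
    have h3 : η * (1 / (1 + ε / 4)) ≤ b * (η / (b + η * r)) := by
      rw [mul_div_assoc', mul_div_assoc', mul_one, div_le_div_iff₀ (by positivity) (by positivity)]
      nlinarith
    have h4 : 2 * r = η * (ε / 4) := by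
      rw [hηdef]
      field_simp
      ring
    have h5 : 1 / (1 + ε) ≤ 1 / (1 + ε / 4) - ε / 4 := by
      rw [div_le_iff₀ (by positivity), sub_mul, one_div_mul_eq_div, le_sub_iff_add_le,
        le_div_iff₀ (by positivity)]
      nlinarith [mul_pos hε₀ hε₀, mul_pos hε₀ (sub_pos.mpr hε₁),
        mul_pos (mul_pos hε₀ hε₀) (sub_pos.mpr hε₁)]
    nlinarith [mul_le_mul_of_nonneg_left h5 hη.le]
  refine PosSemidef.of_dotProduct_mulVec_nonneg ?_ fun v => ?_
  · exact (posSemidef_sum _ fun t _ => hF (idx t)).isHermitian.sub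
      (PosSemidef.one.smul (by positivity : (0 : ℝ) ≤ 1 / (1 + ε))).isHermitian
  · have h := le_dotProduct_sum_of_isRoundingRun hη hF hrun hγ v
    have hq : 0 ≤ v ⬝ᵥ v := by
      have := dotProduct_star_self_nonneg v
      rwa [star_trivial] at this
    have h2 := (mul_le_mul_of_nonneg_right hnum hq).trans h
    rw [mul_assoc] at h2
    have h3 := le_of_mul_le_mul_left h2 hη
    rw [star_trivial, sub_mulVec, smul_mulVec, one_mulVec, dotProduct_sub, dotProduct_smul,
      smul_eq_mul]
    linarith

end Greedy

/-! ### Whitening and the objective -/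

section Whitening

variable {n : Type*} [Fintype n] [DecidableEq n]

/-- Nonemptiness of the index type keeps the spectrum nonempty, so that the infimum in `lambdaMin`
is not a default value. -/
theorem le_lambdaMin_of_posSemidef [Nonempty n] {A : Matrix n n ℝ} (hA : A.IsHermitian) {r : ℝ}
    (h : (A - r • (1 : Matrix n n ℝ)).PosSemidef) : r ≤ lambdaMin A := by
  refine le_csInf ?_ fun y hy => ?_
  · rw [hA.spectrum_real_eq_range_eigenvalues]
    exact Set.range_nonempty _
  · have hy' : y - r ∈ spectrum ℝ (A - r • (1 : Matrix n n ℝ)) := by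
      rw [spectrum.mem_iff] at hy ⊢
      rwa [Algebra.algebraMap_eq_smul_one, sub_smul, sub_sub_sub_cancel_right,
        ← Algebra.algebraMap_eq_smul_one]
    exact sub_nonneg.mp ((posSemidef_iff_isHermitian_and_spectrum_nonneg.mp h).2 hy')

theorem posSemidef_whiten (S : Matrix n n ℝ) {H : Matrix n n ℝ} (hH : H.PosSemidef) :
    (whiten S H).PosSemidef := by
  have h := hH.conjTranspose_mul_mul_same (CFC.sqrt S)⁻¹
  rwa [(posSemidef_sqrt S).inv.isHermitian.eq] at h

theorem sum_smul_whiten {ι : Type*} [Fintype ι] (S : Matrix n n ℝ) (z : ι → ℝ)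
    (H : ι → Matrix n n ℝ) : ∑ i, z i • whiten S (H i) = whiten S (∑ i, z i • H i) := by
  simp only [whiten, Finset.mul_sum, Finset.sum_mul, mul_smul_comm, smul_mul_assoc]

theorem sum_whiten {ι : Type*} [Fintype ι] (S : Matrix n n ℝ) (H : ι → Matrix n n ℝ) :
    ∑ i, whiten S (H i) = whiten S (∑ i, H i) := by
  simp only [whiten, Finset.mul_sum, Finset.sum_mul]

theorem sqrt_mul_whiten_mul_sqrt {S : Matrix n n ℝ} (hS : S.PosDef) (H : Matrix n n ℝ) :
    CFC.sqrt S * whiten S H * CFC.sqrt S = H := by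
  have hQ := posDef_sqrt hS
  rw [whiten, mul_assoc, mul_assoc _ _ (CFC.sqrt S), posDef_inv_mul hQ, mul_one, ← mul_assoc,
    posDef_mul_inv hQ, one_mul]

theorem whiten_self {S : Matrix n n ℝ} (hS : S.PosDef) : whiten S S = 1 := by
  have hQ := posDef_sqrt hS
  nth_rewrite 2 [← sqrt_mul_self_of_posSemidef hS.posSemidef]
  rw [whiten, ← mul_assoc, posDef_inv_mul hQ, one_mul, posDef_mul_inv hQ]

theorem posSemidef_sub_smul_of_whiten {S H : Matrix n n ℝ} (hS : S.PosDef) {r : ℝ}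
    (h : (whiten S H - r • (1 : Matrix n n ℝ)).PosSemidef) : (H - r • S).PosSemidef := by
  have h1 := h.conjTranspose_mul_mul_same (CFC.sqrt S)
  rwa [(posSemidef_sqrt S).isHermitian.eq, mul_sub, sub_mul, sqrt_mul_whiten_mul_sqrt hS,
    mul_smul_comm, smul_mul_assoc, mul_one, sqrt_mul_self_of_posSemidef hS.posSemidef] at h1

/-- The objective is antitone for the Loewner order, and homogeneous of degree `-1`. -/
theorem objective_le_of_posSemidef_sub {Hp S T : Matrix n n ℝ} (hHp : Hp.PosSemidef)
    (hS : S.PosDef) {r : ℝ} (hr : 0 < r) (hT : T.PosDef) (h : (T - r • S).PosSemidef) :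
    objective Hp T ≤ r⁻¹ * objective Hp S := by
  have h1 := posSemidef_inv_sub_inv (hS.smul hr) hT h
  have hinv : (r • S)⁻¹ = r⁻¹ • S⁻¹ := by
    refine inv_eq_right_inv ?_
    rw [smul_mul_smul_comm, posDef_mul_inv hS, mul_inv_cancel₀ hr.ne', one_smul]
  rw [hinv] at h1
  have h2 := trace_mul_nonneg h1 hHp
  rw [sub_mul, trace_sub, smul_mul_assoc, trace_smul, smul_eq_mul, sub_nonneg] at h2
  rwa [objective, objective, minner_eq_trace_mul hT.inv.isHermitian,
    minner_eq_trace_mul hS.inv.isHermitian]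

end Whitening

/-! ### The relaxed problem bounds the selection problem -/

section Relaxation

variable {n : Type*} [Fintype n] [DecidableEq n]

/-- The indicator of a set of `b` points is a feasible weight of the relaxed problem. -/
theorem objective_le_of_isOptimalValue {m b : ℕ} {Hp : Matrix n n ℝ} {H : Fin m → Matrix n n ℝ}
    {z : Fin m → ℝ} (hz : IsRelaxedSolution b Hp H z) {v : ℝ} (hv : IsOptimalValue b Hp H v) :
    objective Hp (∑ i, z i • H i) ≤ v := by
  obtain ⟨X, hX, hpos, rfl⟩ := hv.1
  have e : ∑ i, (if i ∈ X then (1 : ℝ) else 0) • H i = ∑ i ∈ X, H i := by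
    simp [ite_smul, Finset.sum_ite_mem]
  have hmem : (fun i => if i ∈ X then (1 : ℝ) else 0) ∈ relaxedDomain b H := by
    refine ⟨fun i => by positivity, ?_, ?_⟩
    · simp [hX]
    · rwa [e]
  have h := hz.2 hmem
  simp only [Set.mem_ofPred_eq, e] at h
  exact h

end Relaxation

/-! ### Positivity of the Fisher information -/

section Fisher

variable {k d : ℕ}

theorem posSemidef_fisherInfo (θ : ParamIdx k d → ℝ) (x : Fin d → ℝ) :
    (fisherInfo θ x).PosSemidef := by
  refine posSemidef_sum _ fun y _ => ?_
  have h := posSemidef_vecMulVec_self_star (lossGrad x y θ)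
  rw [star_trivial] at h
  exact h.smul (div_nonneg (Real.exp_pos _).le (sum_exp_logit_pos x θ).le)

theorem posSemidef_pointInfo {n₀ : ℕ} (b : ℕ) (θ₀ : ParamIdx k d → ℝ) (x₀ : Fin n₀ → Fin d → ℝ)
    (x : Fin d → ℝ) : (pointInfo b θ₀ x₀ x).PosSemidef :=
  (posSemidef_fisherInfo θ₀ x).add
    ((posSemidef_sum _ fun i _ => posSemidef_fisherInfo θ₀ (x₀ i)).smul (by positivity))

theorem posSemidef_fisherInfoMean (p : MeasureTheory.Measure (Fin d → ℝ))
    (θ : ParamIdx k d → ℝ)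
    (hp : ∀ a a', MeasureTheory.Integrable (fun u => fisherInfo θ u a a') p) :
    (fisherInfoMean p θ).PosSemidef := by
  refine PosSemidef.of_dotProduct_mulVec_nonneg ?_ fun v => ?_
  · ext a a'
    simp only [fisherInfoMean, conjTranspose_apply, of_apply, star_trivial]
    congr 1
    funext u
    have h := (posSemidef_fisherInfo θ u).isHermitian.apply a a'
    rwa [star_trivial] at h
  · have e : star v ⬝ᵥ (fisherInfoMean p θ *ᵥ v) =
        ∫ u, star v ⬝ᵥ (fisherInfo θ u *ᵥ v) ∂p := by
      simp only [dotProduct, mulVec, fisherInfoMean, of_apply]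
      rw [MeasureTheory.integral_finsetSum _ fun a _ =>
        (MeasureTheory.integrable_finsetSum _ fun a' _ => (hp a a').mul_const _).const_mul _]
      refine Finset.sum_congr rfl fun a _ => ?_
      rw [MeasureTheory.integral_const_mul, MeasureTheory.integral_finsetSum _ fun a' _ =>
        (hp a a').mul_const _]
      simp only [MeasureTheory.integral_mul_const]
    rw [e]
    exact MeasureTheory.integral_nonneg fun u =>
      (posSemidef_fisherInfo θ u).dotProduct_mulVec_nonneg v

end Fisher

end ActiveSelection

theorem mainTheorem1 {k d n₀ m b : ℕ} (hk : 1 ≤ k) (hd : 1 ≤ d)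
    (x₀ : Fin n₀ → Fin d → ℝ) (x : Fin m → Fin d → ℝ)
    (θ₀ : ActiveSelection.ParamIdx k d → ℝ)
    (p : MeasureTheory.Measure (Fin d → ℝ)) [MeasureTheory.IsProbabilityMeasure p]
    (hp : ∀ a a', MeasureTheory.Integrable (fun u => ActiveSelection.fisherInfo θ₀ u a a') p)
    (ε : ℝ) (hε₀ : 0 < ε) (hε₁ : ε < 1)
    (hb : 32 * ((d * k : ℕ) : ℝ) / ε ^ 2 + 16 * Real.sqrt ((d * k : ℕ) : ℝ) / ε ^ 2 ≤ (b : ℝ))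
    (z : Fin m → ℝ)
    (hz : ActiveSelection.IsRelaxedSolution b (ActiveSelection.fisherInfoMean p θ₀)
      (fun i => ActiveSelection.pointInfo b θ₀ x₀ (x i)) z)
    (A : Fin b → Matrix (ActiveSelection.ParamIdx k d) (ActiveSelection.ParamIdx k d) ℝ)
    (idx : Fin b → Fin m)
    (hrun : ActiveSelection.IsRoundingRun (8 * Real.sqrt ((d * k : ℕ) : ℝ) / ε)
      (fun i => ActiveSelection.whiten
        (∑ j, z j • ActiveSelection.pointInfo b θ₀ x₀ (x j))
        (ActiveSelection.pointInfo b θ₀ x₀ (x i))) A idx) :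
    1 / (1 + ε) ≤ ActiveSelection.lambdaMin
      (∑ t, ActiveSelection.whiten
        (∑ j, z j • ActiveSelection.pointInfo b θ₀ x₀ (x j))
        (ActiveSelection.pointInfo b θ₀ x₀ (x (idx t)))) ∧
    (∑ t, ActiveSelection.pointInfo b θ₀ x₀ (x (idx t))).PosDef ∧
    ∀ fstar : ℝ,
      ActiveSelection.IsOptimalValue b (ActiveSelection.fisherInfoMean p θ₀)
        (fun i => ActiveSelection.pointInfo b θ₀ x₀ (x i)) fstar →
      ActiveSelection.objective (ActiveSelection.fisherInfoMean p θ₀)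
        (∑ t, ActiveSelection.pointInfo b θ₀ x₀ (x (idx t))) ≤ (1 + ε) * fstar := by
  have hne : Nonempty (ActiveSelection.ParamIdx k d) := ⟨(⟨0, hk⟩, ⟨0, hd⟩)⟩
  have hcard : ((d * k : ℕ) : ℝ) = (Fintype.card (ActiveSelection.ParamIdx k d) : ℝ) := by
    rw [Fintype.card_prod, Fintype.card_fin, Fintype.card_fin, mul_comm]
  rw [hcard] at hb hrun
  set H : Fin m → Matrix (ActiveSelection.ParamIdx k d) (ActiveSelection.ParamIdx k d) ℝ :=
    fun i => ActiveSelection.pointInfo b θ₀ x₀ (x i)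
  have hH : ∀ i, (H i).PosSemidef := fun i => ActiveSelection.posSemidef_pointInfo b θ₀ x₀ (x i)
  obtain ⟨hz0, hzb, hS⟩ := hz.1
  set S := ∑ j, z j • H j
  have hr : 0 < 1 / (1 + ε) := by positivity
  have hF := ActiveSelection.posSemidef_sum_sub_of_isRoundingRun hε₀ hε₁ hb
    (fun i => ActiveSelection.posSemidef_whiten S (hH i)) hz0 hzb
    (by rw [ActiveSelection.sum_smul_whiten]; exact ActiveSelection.whiten_self hS) hrun
  have hFh : (∑ t, ActiveSelection.whiten S (H (idx t))).IsHermitian :=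
    (Matrix.posSemidef_sum _ fun t _ =>
      ActiveSelection.posSemidef_whiten S (hH (idx t))).isHermitian
  have hT := hF
  rw [ActiveSelection.sum_whiten S fun t => H (idx t)] at hT
  replace hT := ActiveSelection.posSemidef_sub_smul_of_whiten hS hT
  have hTpos : (∑ t, H (idx t)).PosDef := by
    have h := (hS.smul hr).add_posSemidef hT
    rwa [add_sub_cancel] at h
  refine ⟨ActiveSelection.le_lambdaMin_of_posSemidef hFh hF, hTpos, fun fstar hf => ?_⟩
  have h := ActiveSelection.objective_le_of_posSemidef_sub
    (ActiveSelection.posSemidef_fisherInfoMean p θ₀ hp) hS hr hTpos hT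
  rw [one_div, inv_inv] at h
  exact h.trans (mul_le_mul_of_nonneg_left
    (ActiveSelection.objective_le_of_isOptimalValue hz hf) (by positivity))
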